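/- There is an absolute constant $N$ such that the following holds for all integers $r,h\ge N$ with $$\min\{r+1,h\}\ \ge\ 10\,(\ln\max\{r+1,h\})^2 .$$ Let $A$ be a finite subset of an abelian group, let $K$ be a real number with $|A+A|=K|A|$, and let $\lambda_1,\dots,\lambda_h$ be nonzero integers (not necessarily distinct) with $|\lambda_i|\le 2^r$ for all $i$. Then $$|\lambda_1\cdot A+\dots+\lambda_h\cdot A|\ \le\ K^{7rh/\ln(r+h)}\,|A| .$$ Here $X+Y=\{x+y: x\in X,\ y\in Y\}$ is the sumset, $\lambda\cdot A=\{\lambda a: a\in A\}$ is the dilate of $A$ by $\lambda$, and $\ln$ is the natural logarithm. -/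

import Mathlib

open scoped Pointwise

/-- The dilate `c · A = {c a : a ∈ A}` of a finite subset `A` of an abelian group by an integer `c`.
It is written as an image because `c • A` could also be read as an iterated sumset. -/
def dilate {G : Type*} [AddCommGroup G] [DecidableEq G] (c : ℤ) (A : Finset G) : Finset G :=
  A.image (fun a => c • a)

/-! ### Covering sums of dilates by translates of `A - A`. -/

section AdditiveCovering

variable {G : Type*} [AddCommGroup G] [DecidableEq G]

/-! Write each `|λ_i|` in binary and view the pairs (coefficient `i`, digit position `j` carrying a
1) as edges of a bipartite graph. Split the edges into bicliques `X_k × Y_k` and put `γ_k = ∑_{j ∈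
Y_k} 2^j`. With `s_i` the sign of `λ_i`, `∑ λ_i a_i = ∑_k γ_k ∑_{i ∈ X_k} s_i a_i`. By Plünnecke and
Ruzsa covering, each inner sum is `f_k + e_k` with at most `K^(|X_k|+1)` choices of `f_k` and `e_k ∈
A - A`. Regrouping `∑ γ_k e_k` by powers of 2, a Horner scheme covers it at a cost governed by `∑
|Y_k|`. So the exponent is about `∑ |X_k| + 2 ∑ |Y_k|` (`card_sum_dilate_le_of_bicliques`).

Let `m ≤ M` be the sizes `r + 1` and `h` in increasing order. Cutting the smaller side into blocks
of length `⌊log M⌋` and sorting the larger side by its pattern on each block makes the exponent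
`O(mM / log M)` (`exists_biclique_partition`, `exponent_bound`). -/

theorem dilate_card_le (c : ℤ) (A : Finset G) : (dilate c A).card ≤ A.card :=
  Finset.card_image_le

theorem card_finsetSum_le_prod {κ : Type*} (s : Finset κ) (F : κ → Finset G) :
    (∑ k ∈ s, F k).card ≤ ∏ k ∈ s, (F k).card := by
  classical
  induction s using Finset.induction_on with
  | empty => simp
  | insert a s ha ih =>
    rw [Finset.sum_insert ha, Finset.prod_insert ha]
    exact Finset.card_add_le.trans (Nat.mul_le_mul_left _ ih)

theorem mem_finsetSum_of_forall {κ : Type*} (s : Finset κ) (F : κ → Finset G) (f : κ → G)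
    (hf : ∀ k ∈ s, f k ∈ F k) : ∑ k ∈ s, f k ∈ ∑ k ∈ s, F k := by
  rw [← Finset.mem_coe, Finset.coe_sum]
  exact Set.finsetSum_mem_finsetSum s _ f hf

theorem sum_mem_card_nsmul {ι : Type*} (s : Finset ι) (A : Finset G) (a : ι → G)
    (ha : ∀ i ∈ s, a i ∈ A) : ∑ i ∈ s, a i ∈ s.card • A := by
  rw [← Finset.sum_const]
  exact mem_finsetSum_of_forall s _ a ha

/-- **Plünnecke–Ruzsa and Ruzsa covering**: `m A - n A` is covered by few translates of `A - A`. -/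
theorem exists_cover_nsmul_sub_nsmul {A : Finset G} (hA : A.Nonempty) {K : ℝ}
    (hK : ((A + A).card : ℝ) = K * A.card) (m n : ℕ) :
    ∃ F : Finset G, (F.card : ℝ) ≤ K ^ (m + n + 1) ∧ m • A - n • A ⊆ F + (A - A) := by
  have hpos : (0 : ℝ) < A.card := by exact_mod_cast hA.card_pos
  have hq : ((A + A).card : ℝ) / A.card = K := by rw [hK]; field_simp
  -- The extra copy of `A` is the one that Ruzsa covering adds to `m A - n A`.
  have h1 : ((((m + 1) • A - n • A).card : ℝ)) ≤ K ^ (m + n + 1) * A.card := by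
    have h := Finset.pluennecke_ruzsa_inequality_nsmul_sub_nsmul_add hA A (m + 1) n
    have h' : ((((m + 1) • A - n • A).card : ℚ≥0) : ℝ) ≤
        ((((A + A).card / A.card : ℚ≥0) ^ (m + 1 + n) * A.card : ℚ≥0) : ℝ) := by
      exact_mod_cast h
    push_cast at h'
    rw [hq] at h'
    rwa [show m + n + 1 = m + 1 + n by ring]
  have h2 : m • A - n • A + A = (m + 1) • A - n • A := by
    rw [succ_nsmul, sub_add_eq_add_sub]
  obtain ⟨F, -, hF, hsub⟩ := Finset.ruzsa_covering_add (A := m • A - n • A) (B := A) hA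
    (K := K ^ (m + n + 1)) (by rwa [h2])
  exact ⟨F, hF, hsub⟩

theorem card_sub_self_le {A : Finset G} (hA : A.Nonempty) {K : ℝ}
    (hK : ((A + A).card : ℝ) = K * A.card) : ((A - A).card : ℝ) ≤ K ^ 2 * A.card := by
  have h := Finset.pluennecke_ruzsa_inequality_nsmul_sub_nsmul_add hA A 1 1
  have h' : (((1 • A - 1 • A).card : ℚ≥0) : ℝ) ≤
      ((((A + A).card / A.card : ℚ≥0) ^ (1 + 1) * A.card : ℚ≥0) : ℝ) := by
    exact_mod_cast h
  push_cast at h'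
  have hpos : (0 : ℝ) < A.card := by exact_mod_cast hA.card_pos
  rw [show ((A + A).card : ℝ) / A.card = K by rw [hK]; field_simp] at h'
  simpa using h'

theorem sum_card_filter_mem {κ : Type*} [Fintype κ] (n : ℕ) (Y : κ → Finset ℕ)
    (hY : ∀ k, Y k ⊆ Finset.range n) :
    ∑ j ∈ Finset.range n, (Finset.univ.filter fun k => j ∈ Y k).card = ∑ k, (Y k).card := by
  simp_rw [Finset.card_filter]
  rw [Finset.sum_comm]
  refine Finset.sum_congr rfl fun k _ => ?_
  rw [Finset.sum_ite_mem, Finset.inter_eq_right.2 (hY k)]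
  simp

/-- Horner's scheme: cover the tail of the sum, double it, and absorb the doubled `A - A` remainder
into the digit-0 term. -/
theorem exists_cover_sum_two_pow {A : Finset G} (hA : A.Nonempty) {K : ℝ}
    (hK : ((A + A).card : ℝ) = K * A.card) (n : ℕ) (d : ℕ → ℕ) :
    ∃ F : Finset G, (F.card : ℝ) ≤ K ^ (∑ j ∈ Finset.range n, (2 * d j + 5)) ∧
      ∀ w : ℕ → G, (∀ j ∈ Finset.range n, w j ∈ d j • A - d j • A) →
        ∑ j ∈ Finset.range n, 2 ^ j • w j ∈ F + (A - A) := by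
  induction n generalizing d with
  | zero =>
    refine ⟨{0}, by simp, fun w _ => ?_⟩
    obtain ⟨a, ha⟩ := hA
    rw [Finset.sum_range_zero, ← zero_add (0 : G)]
    exact Finset.add_mem_add (by simp) (Finset.mem_sub.2 ⟨a, ha, a, ha, sub_self a⟩)
  | succ n ih =>
    obtain ⟨F, hF, hcov⟩ := ih fun j => d (j + 1)
    -- Doubling the remainder `a - a'` adds two summands on each side, hence `d 0 + 2`; the cost is
    -- `2 (d 0 + 2) + 1 = 2 d 0 + 5`.
    obtain ⟨F', hF', hcov'⟩ := exists_cover_nsmul_sub_nsmul hA hK (d 0 + 2) (d 0 + 2)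
    refine ⟨F.image (fun x => 2 • x) + F', ?_, fun w hw => ?_⟩
    · have h : ((F.image (fun x => 2 • x) + F').card : ℝ) ≤ F.card * F'.card := by
        exact_mod_cast Finset.card_add_le.trans (Nat.mul_le_mul_right _ Finset.card_image_le)
      refine h.trans ((mul_le_mul hF hF' (by positivity)
        ((Nat.cast_nonneg _).trans hF)).trans (le_of_eq ?_))
      rw [← pow_add, Finset.sum_range_succ']
      congr 1
      ring
    · have h := hcov (fun j => w (j + 1)) fun j hj => hw (j + 1) (by simpa using hj)
      obtain ⟨f, hf, e, he, hfe⟩ := Finset.mem_add.1 h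
      obtain ⟨a, ha, a', ha', rfl⟩ := Finset.mem_sub.1 he
      obtain ⟨u, hu, v, hv, huv⟩ := Finset.mem_sub.1 (hw 0 (by simp))
      have hsum : ∑ j ∈ Finset.range (n + 1), 2 ^ j • w j =
          2 • f + ((u + 2 • a) - (v + 2 • a')) := by
        rw [Finset.sum_range_succ']
        have : ∑ j ∈ Finset.range n, 2 ^ (j + 1) • w (j + 1) =
            2 • ∑ j ∈ Finset.range n, 2 ^ j • w (j + 1) := by
          rw [Finset.smul_sum]
          refine Finset.sum_congr rfl fun j _ => ?_
          rw [pow_succ', mul_smul]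
        rw [this, ← hfe, ← huv]
        simp only [pow_zero, one_smul, smul_add, smul_sub]
        abel
      have hmem : (u + 2 • a) - (v + 2 • a') ∈ (d 0 + 2) • A - (d 0 + 2) • A := by
        rw [add_nsmul]
        refine Finset.sub_mem_sub (Finset.add_mem_add hu ?_) (Finset.add_mem_add hv ?_) <;>
          rw [two_nsmul, two_nsmul]
        exacts [Finset.add_mem_add ha ha, Finset.add_mem_add ha' ha']
      rw [hsum, add_assoc]
      exact Finset.add_mem_add (Finset.mem_image_of_mem _ hf) (hcov' hmem)

theorem exists_cover_signed_sum {A : Finset G} (hA : A.Nonempty) {K : ℝ}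
    (hK : ((A + A).card : ℝ) = K * A.card) {ι : Type*} (s : ι → ℤ)
    (hs : ∀ i, s i = 1 ∨ s i = -1) (X : Finset ι) :
    ∃ F : Finset G, (F.card : ℝ) ≤ K ^ (X.card + 1) ∧
      ∀ a : ι → G, (∀ i, a i ∈ A) → ∑ i ∈ X, s i • a i ∈ F + (A - A) := by
  obtain ⟨F, hF, hcov⟩ := exists_cover_nsmul_sub_nsmul hA hK
    (X.filter fun i => s i = 1).card (X.filter fun i => ¬ s i = 1).card
  rw [Finset.card_filter_add_card_filter_not] at hF
  refine ⟨F, hF, fun a ha => hcov ?_⟩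
  rw [← Finset.sum_filter_add_sum_filter_not X fun i => s i = 1]
  refine Finset.mem_sub.2 ⟨_, sum_mem_card_nsmul _ A a fun i _ => ha i, _,
    sum_mem_card_nsmul _ A a fun i _ => ha i, ?_⟩
  rw [sub_eq_add_neg, ← Finset.sum_neg_distrib]
  congr 1 <;> refine Finset.sum_congr rfl fun i hi => ?_
  · rw [(Finset.mem_filter.1 hi).2, one_smul]
  · rw [(hs i).resolve_left (Finset.mem_filter.1 hi).2, neg_smul, one_smul]

/-- Substituting covers of the biclique sums and of the digit sums into a sum of dilates. -/
theorem sum_dilate_subset_of_covers {A : Finset G} {ι κ : Type*} [Fintype ι] [Fintype κ]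
    [DecidableEq ι] (lam s : ι → ℤ) (n : ℕ) (X : κ → Finset ι) (Y : κ → Finset ℕ)
    (hY : ∀ k, Y k ⊆ Finset.range n)
    (hlam : ∀ i, lam i = s i * ∑ k with i ∈ X k, ∑ j ∈ Y k, 2 ^ j)
    (F : κ → Finset G) (F' : Finset G)
    (hcov : ∀ k, ∀ a : ι → G, (∀ i, a i ∈ A) → ∑ i ∈ X k, s i • a i ∈ F k + (A - A))
    (hcov' : ∀ w : ℕ → G, (∀ j ∈ Finset.range n, w j ∈
      (Finset.univ.filter fun k => j ∈ Y k).card • A -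
        (Finset.univ.filter fun k => j ∈ Y k).card • A) →
      ∑ j ∈ Finset.range n, 2 ^ j • w j ∈ F' + (A - A)) :
    ∑ i, dilate (lam i) A ⊆ ∑ k, dilate (∑ j ∈ Y k, 2 ^ j) (F k) + (F' + (A - A)) := by
  set γ : κ → ℤ := fun k => ∑ j ∈ Y k, 2 ^ j with hγ
  intro x hx
  rw [← Finset.mem_coe, Finset.coe_sum, Set.mem_fintype_sum] at hx
  obtain ⟨g, hg, rfl⟩ := hx
  have hg' : ∀ i, ∃ a ∈ A, lam i • a = g i := fun i => Finset.mem_image.1 (hg i)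
  choose a ha hag using hg'
  choose f hf e he hfe using fun k => Finset.mem_add.1 (hcov k a ha)
  choose u hu v hv huv using fun k => Finset.mem_sub.1 (he k)
  have h1 : ∑ i, g i = ∑ k, γ k • ∑ i ∈ X k, s i • a i := by
    have : ∀ i, g i = ∑ k, if i ∈ X k then γ k • s i • a i else 0 := fun i => by
      rw [← hag i, hlam i, mul_comm, mul_smul, Finset.sum_smul, Finset.sum_filter]
    simp_rw [this]
    rw [Finset.sum_comm]
    refine Finset.sum_congr rfl fun k _ => ?_
    rw [Finset.smul_sum, Finset.sum_ite_mem, Finset.univ_inter]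
  -- The remainders are regrouped by digit: position `j` collects one element of `A - A` from each
  -- biclique with `j ∈ Y k`.
  have h2 : ∑ k, γ k • e k =
      ∑ j ∈ Finset.range n, 2 ^ j • ∑ k with j ∈ Y k, e k := by
    have : ∀ k, γ k • e k = ∑ j ∈ Finset.range n, if j ∈ Y k then 2 ^ j • e k else 0 := by
      intro k
      rw [Finset.sum_ite_mem, Finset.inter_eq_right.2 (hY k), hγ, Finset.sum_smul]
      refine Finset.sum_congr rfl fun j _ => ?_
      rw [← natCast_zsmul]
      push_cast
      rfl
    simp_rw [this]
    rw [Finset.sum_comm]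
    refine Finset.sum_congr rfl fun j _ => ?_
    rw [Finset.smul_sum, Finset.sum_filter]
  have h3 : ∑ k, γ k • e k ∈ F' + (A - A) := by
    rw [h2]
    refine hcov' _ fun j _ => ?_
    refine Finset.mem_sub.2 ⟨_, sum_mem_card_nsmul _ A u fun k _ => hu k, _,
      sum_mem_card_nsmul _ A v fun k _ => hv k, ?_⟩
    rw [← Finset.sum_sub_distrib]
    exact Finset.sum_congr rfl fun k _ => huv k
  have h4 : ∑ i, g i = ∑ k, γ k • f k + ∑ k, γ k • e k := by
    rw [h1, ← Finset.sum_add_distrib]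
    refine Finset.sum_congr rfl fun k _ => ?_
    rw [← hfe k, smul_add]
  rw [h4]
  exact Finset.add_mem_add (mem_finsetSum_of_forall _ _ _ fun k _ =>
    Finset.mem_image_of_mem _ (hf k)) h3

/-- A biclique decomposition of the binary digits of the coefficients bounds a sum of dilates. -/
theorem card_sum_dilate_le_of_bicliques {A : Finset G} (hA : A.Nonempty) {K : ℝ}
    (hK : ((A + A).card : ℝ) = K * A.card) {ι κ : Type*} [Fintype ι] [Fintype κ] [DecidableEq ι]
    (lam s : ι → ℤ) (hs : ∀ i, s i = 1 ∨ s i = -1) (n : ℕ)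
    (X : κ → Finset ι) (Y : κ → Finset ℕ) (hY : ∀ k, Y k ⊆ Finset.range n)
    (hlam : ∀ i, lam i = s i * ∑ k with i ∈ X k, ∑ j ∈ Y k, 2 ^ j) :
    ((∑ i, dilate (lam i) A).card : ℝ) ≤
      K ^ (∑ k, (X k).card + Fintype.card κ + 2 * ∑ k, (Y k).card + 5 * n + 2) * A.card := by
  choose F hF hcov using fun k => exists_cover_signed_sum hA hK s hs (X k)
  set d : ℕ → ℕ := fun j => (Finset.univ.filter fun k => j ∈ Y k).card with hd
  obtain ⟨F', hF', hcov'⟩ := exists_cover_sum_two_pow hA hK n d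
  have hsub := sum_dilate_subset_of_covers lam s n X Y hY hlam F F' hcov hcov'
  have hcard : ((∑ i, dilate (lam i) A).card : ℝ) ≤
      (∏ k, ((F k).card : ℝ)) * (F'.card * (A - A).card) := by
    have h1 : (∑ k, dilate (∑ j ∈ Y k, 2 ^ j) (F k)).card ≤ ∏ k, (F k).card :=
      (card_finsetSum_le_prod _ _).trans (Finset.prod_le_prod' fun k _ => dilate_card_le _ _)
    exact_mod_cast (Finset.card_le_card hsub).trans (Finset.card_add_le.trans
      (Nat.mul_le_mul h1 Finset.card_add_le))
  have hprod : (∏ k, ((F k).card : ℝ)) ≤ K ^ (∑ k, (X k).card + Fintype.card κ) := by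
    refine (Finset.prod_le_prod (fun k _ => Nat.cast_nonneg _) fun k _ => hF k).trans (le_of_eq ?_)
    rw [Finset.prod_pow_eq_pow_sum, Finset.sum_add_distrib]
    simp
  have hdiff := card_sub_self_le hA hK
  have hdsum : ∑ j ∈ Finset.range n, (2 * d j + 5) = 2 * ∑ k, (Y k).card + 5 * n := by
    rw [Finset.sum_add_distrib, ← Finset.mul_sum, sum_card_filter_mem n Y hY]
    simp [mul_comm]
  rw [hdsum] at hF'
  have hP0 : (0 : ℝ) ≤ ∏ k, ((F k).card : ℝ) :=
    Finset.prod_nonneg fun k _ => Nat.cast_nonneg _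
  calc ((∑ i, dilate (lam i) A).card : ℝ)
      ≤ (∏ k, ((F k).card : ℝ)) * (F'.card * (A - A).card) := hcard
    _ ≤ K ^ (∑ k, (X k).card + Fintype.card κ) *
        (K ^ (2 * ∑ k, (Y k).card + 5 * n) * (K ^ 2 * A.card)) :=
        mul_le_mul hprod (mul_le_mul hF' hdiff (Nat.cast_nonneg _)
          ((Nat.cast_nonneg _).trans hF'))
          (mul_nonneg (Nat.cast_nonneg _) (Nat.cast_nonneg _)) (hP0.trans hprod)
    _ = _ := by ring

end AdditiveCovering

/-! ### Biclique partitions and binary digits. -/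

section Bicliques

/-- Edge partition of a bipartite graph with parts `ι` and `Fin n` into bicliques, obtained by
cutting `Fin n` into blocks of size `b` and sorting `ι` by adjacency pattern on each block. -/
theorem exists_biclique_partition {ι : Type*} [Fintype ι] [DecidableEq ι] (n b : ℕ) (hb : 0 < b)
    (R : ι → ℕ → Prop) :
    ∃ (X : Fin (n / b + 1) × Finset (Fin b) → Finset ι)
      (Y : Fin (n / b + 1) × Finset (Fin b) → Finset ℕ),
      (∀ k, Y k ⊆ Finset.range n) ∧
      (∀ i, ∀ j < n, ∀ (_ : Decidable (R i j)),
        (Finset.univ.filter fun k => i ∈ X k ∧ j ∈ Y k).card = if R i j then 1 else 0) ∧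
      ∑ k, (X k).card ≤ Fintype.card ι * (n / b + 1) ∧
      ∑ k, (Y k).card ≤ n * 2 ^ b := by
  classical
  set pat : ι → ℕ → Finset (Fin b) := fun i q =>
    Finset.univ.filter fun t => R i (b * q + t) with hpat
  have hdiv : ∀ j < n, j / b < n / b + 1 := fun j hj =>
    Nat.lt_succ_of_le (Nat.div_le_div_right hj.le)
  -- The biclique `(q, P)` joins the `i` with pattern `P` on block `q` to the positions of that
  -- block in `P`. Each `i` has one pattern per block; each `j` meets at most `2 ^ b` patterns.
  refine ⟨fun k => Finset.univ.filter fun i => pat i k.1 = k.2,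
    fun k => (Finset.range n).filter fun j => j / b = k.1 ∧ (⟨j % b, Nat.mod_lt _ hb⟩ : Fin b) ∈ k.2,
    fun k => Finset.filter_subset _ _, ?_, ?_, ?_⟩
  · intro i j hj _
    have hmem : (⟨j % b, Nat.mod_lt _ hb⟩ : Fin b) ∈ pat i (j / b) ↔ R i j := by
      simp [hpat, Nat.div_add_mod]
    have : (Finset.univ.filter fun k : Fin (n / b + 1) × Finset (Fin b) =>
        i ∈ (Finset.univ.filter fun i => pat i k.1 = k.2) ∧
        j ∈ (Finset.range n).filter fun j => j / b = k.1 ∧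
          (⟨j % b, Nat.mod_lt _ hb⟩ : Fin b) ∈ k.2) =
        if R i j then {(⟨j / b, hdiv j hj⟩, pat i (j / b))} else ∅ := by
      ext ⟨q, P⟩
      simp only [Finset.mem_filter, Finset.mem_univ, true_and, Finset.mem_range]
      constructor
      · rintro ⟨rfl, -, hq, hm⟩
        rw [← hq, hmem] at hm
        rw [if_pos hm, Finset.mem_singleton]
        exact Prod.ext (Fin.ext hq.symm) (by simp [hq])
      · intro h
        split_ifs at h with hR
        · rw [Finset.mem_singleton] at h
          obtain ⟨rfl, rfl⟩ := Prod.ext_iff.1 h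
          exact ⟨rfl, hj, rfl, hmem.2 hR⟩
        · simp at h
    rw [this]
    split_ifs <;> simp
  · simp_rw [Finset.card_filter]
    rw [Finset.sum_comm, Fintype.card, Finset.card_eq_sum_ones, Finset.sum_mul]
    refine Finset.sum_le_sum fun i _ => ?_
    rw [Fintype.sum_prod_type]
    simp
  · simp_rw [Finset.card_filter]
    rw [Finset.sum_comm]
    have : ∀ j ∈ Finset.range n, (∑ k : Fin (n / b + 1) × Finset (Fin b),
        if j / b = k.1 ∧ (⟨j % b, Nat.mod_lt _ hb⟩ : Fin b) ∈ k.2 then 1 else 0) ≤ 2 ^ b := by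
      intro j hj
      rw [Fintype.sum_prod_type, Finset.sum_eq_single ⟨j / b, hdiv j (Finset.mem_range.1 hj)⟩]
      · refine (Finset.sum_le_sum (g := fun _ => 1) fun P _ => ?_).trans ?_
        · split_ifs <;> simp
        · simp
      · intro q _ hq
        refine Finset.sum_eq_zero fun P _ => if_neg fun h => hq (Fin.ext h.1.symm)
      · simp
    simpa using Finset.sum_le_sum this

theorem exists_finset_sum_two_pow (n m : ℕ) (hm : m < 2 ^ n) :
    ∃ S ⊆ Finset.range n, ∑ j ∈ S, 2 ^ j = m := by
  refine ⟨m.bitIndices.toFinset, fun j hj => ?_, Finset.sum_toFinset_bitIndices_two_pow m⟩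
  rw [Finset.mem_range]
  have h1 : 2 ^ j ≤ m := by
    conv_rhs => rw [← Finset.sum_toFinset_bitIndices_two_pow m]
    exact Finset.single_le_sum (f := fun j => 2 ^ j) (fun _ _ => Nat.zero_le _) hj
  exact (Nat.pow_lt_pow_iff_right one_lt_two).1 (h1.trans_lt hm)

/-- If bicliques partition the digit relation `j ∈ S i`, they reproduce the numbers `∑_{S i} 2^j`. -/
theorem sum_two_pow_eq_of_partition {ι κ : Type*} [Fintype κ] [DecidableEq ι] (n : ℕ)
    (S : ι → Finset ℕ) (hS : ∀ i, S i ⊆ Finset.range n) (X : κ → Finset ι) (Y : κ → Finset ℕ)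
    (hY : ∀ k, Y k ⊆ Finset.range n)
    (h : ∀ i, ∀ j < n, (Finset.univ.filter fun k => i ∈ X k ∧ j ∈ Y k).card =
      if j ∈ S i then 1 else 0) (i : ι) :
    ∑ j ∈ S i, (2 : ℤ) ^ j = ∑ k with i ∈ X k, ∑ j ∈ Y k, 2 ^ j := by
  have h1 : ∀ T ⊆ Finset.range n, ∑ j ∈ T, (2 : ℤ) ^ j =
      ∑ j ∈ Finset.range n, if j ∈ T then 2 ^ j else 0 := fun T hT => by
    rw [Finset.sum_ite_mem, Finset.inter_eq_right.2 hT]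
  rw [h1 _ (hS i), Finset.sum_congr rfl fun k _ => h1 _ (hY k), Finset.sum_comm]
  refine Finset.sum_congr rfl fun j hj => ?_
  rw [← Finset.sum_filter, Finset.filter_filter, Finset.sum_const, h i j (Finset.mem_range.1 hj)]
  split_ifs <;> simp

end Bicliques

/-! ### The two exponents, one for each side that is cut. -/

section Bounds

variable {G : Type*} [AddCommGroup G] [DecidableEq G]

theorem exists_sign_digits {ι : Type*} (lam : ι → ℤ) (n : ℕ) (h0 : ∀ i, lam i ≠ 0)
    (hn : ∀ i, |lam i| < 2 ^ n) :
    ∃ (s : ι → ℤ) (S : ι → Finset ℕ), (∀ i, s i = 1 ∨ s i = -1) ∧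
      (∀ i, S i ⊆ Finset.range n) ∧ ∀ i, lam i = s i * ∑ j ∈ S i, (2 : ℤ) ^ j := by
  have hlt : ∀ i, (lam i).natAbs < 2 ^ n := fun i => by
    have := hn i
    rw [Int.abs_eq_natAbs] at this
    exact_mod_cast this
  choose S hS hsum using fun i => exists_finset_sum_two_pow n _ (hlt i)
  refine ⟨fun i => (lam i).sign, S, fun i => ?_, hS, fun i => ?_⟩
  · rcases lt_or_gt_of_ne (h0 i) with h | h
    · exact Or.inr (Int.sign_eq_neg_one_of_neg h)
    · exact Or.inl (Int.sign_eq_one_of_pos h)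
  · have : ∑ j ∈ S i, (2 : ℤ) ^ j = (lam i).natAbs := by exact_mod_cast hsum i
    rw [this, Int.sign_mul_natAbs]

/-- Bound obtained by cutting the digit positions into blocks. -/
theorem card_sum_dilate_le_of_digit_blocks {A : Finset G} (hA : A.Nonempty) {K : ℝ} (hK1 : 1 ≤ K)
    (hK : ((A + A).card : ℝ) = K * A.card) {h : ℕ} (lam : Fin h → ℤ) (h0 : ∀ i, lam i ≠ 0)
    (n : ℕ) (hn : ∀ i, |lam i| < 2 ^ n) (b : ℕ) (hb : 0 < b) :
    ((∑ i, dilate (lam i) A).card : ℝ) ≤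
      K ^ (h * (n / b + 1) + (n / b + 1) * 2 ^ b + 2 * (n * 2 ^ b) + 5 * n + 2) * A.card := by
  obtain ⟨s, S, hs, hS, hlam⟩ := exists_sign_digits lam n h0 hn
  obtain ⟨X, Y, hY, hR, hX', hY'⟩ := exists_biclique_partition n b hb fun i j => j ∈ S i
  refine (card_sum_dilate_le_of_bicliques hA hK lam s hs n X Y hY fun i => ?_).trans
    (mul_le_mul_of_nonneg_right (pow_le_pow_right₀ hK1 ?_) (Nat.cast_nonneg _))
  · rw [hlam i, sum_two_pow_eq_of_partition n S hS X Y hY fun i j hj => hR i j hj _]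
  · have : Fintype.card (Fin (n / b + 1) × Finset (Fin b)) = (n / b + 1) * 2 ^ b := by simp
    rw [this]
    rw [Fintype.card_fin] at hX'
    gcongr

/-- Bound obtained by cutting the set of coefficients into blocks. -/
theorem card_sum_dilate_le_of_coefficient_blocks {A : Finset G} (hA : A.Nonempty) {K : ℝ}
    (hK1 : 1 ≤ K) (hK : ((A + A).card : ℝ) = K * A.card) {h : ℕ} (lam : Fin h → ℤ)
    (h0 : ∀ i, lam i ≠ 0) (n : ℕ) (hn : ∀ i, |lam i| < 2 ^ n) (b : ℕ) (hb : 0 < b) :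
    ((∑ i, dilate (lam i) A).card : ℝ) ≤
      K ^ (h * 2 ^ b + (h / b + 1) * 2 ^ b + 2 * (n * (h / b + 1)) + 5 * n + 2) * A.card := by
  obtain ⟨s, S, hs, hS, hlam⟩ := exists_sign_digits lam n h0 hn
  -- The transposed graph: digit positions are sorted by their pattern on blocks of coefficients.
  obtain ⟨Y, X, hX, hR, hY', hX'⟩ := exists_biclique_partition (ι := Fin n) h b hb
    fun j i => ∃ hi : i < h, (j : ℕ) ∈ S ⟨i, hi⟩
  have hYn : ∀ k, (Y k).map Fin.valEmbedding ⊆ Finset.range n := fun k j hj => by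
    obtain ⟨j', -, rfl⟩ := Finset.mem_map.1 hj
    simp
  have hcard : ∀ k, (Finset.univ.filter fun i : Fin h => (i : ℕ) ∈ X k).card = (X k).card := by
    intro k
    rw [← Finset.card_map Fin.valEmbedding]
    congr 1
    ext i
    simp only [Finset.mem_map, Finset.mem_filter, Finset.mem_univ, true_and, Fin.valEmbedding_apply]
    exact ⟨fun ⟨_, ha, he⟩ => he ▸ ha, fun hi => ⟨⟨i, Finset.mem_range.1 (hX k hi)⟩, hi, rfl⟩⟩
  refine (card_sum_dilate_le_of_bicliques hA hK lam s hs n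
    (fun k => Finset.univ.filter fun i : Fin h => (i : ℕ) ∈ X k)
    (fun k => (Y k).map Fin.valEmbedding) hYn fun i => ?_).trans
    (mul_le_mul_of_nonneg_right (pow_le_pow_right₀ hK1 ?_) (Nat.cast_nonneg _))
  · rw [hlam i, sum_two_pow_eq_of_partition n S hS _ _ hYn fun i j hj => ?_]
    classical
    have := hR ⟨j, hj⟩ i i.2 inferInstance
    simp only [Fin.is_lt, Fin.eta, exists_true_left] at this
    have hmem : ∀ k, j ∈ (Y k).map Fin.valEmbedding ↔ (⟨j, hj⟩ : Fin n) ∈ Y k := fun k => by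
      simp only [Finset.mem_map, Fin.valEmbedding_apply]
      exact ⟨fun ⟨a, ha, he⟩ => by subst he; exact ha, fun hi => ⟨_, hi, rfl⟩⟩
    simp_rw [hmem]
    simp only [Finset.mem_filter, Finset.mem_univ, true_and]
    simp_rw [and_comm (a := (i : ℕ) ∈ X _)]
    exact this
  · have : Fintype.card (Fin (h / b + 1) × Finset (Fin b)) = (h / b + 1) * 2 ^ b := by simp
    rw [this]
    simp_rw [hcard, Finset.card_map]
    rw [Fintype.card_fin] at hY'
    gcongr

end Bounds

/-! ### Comparing the exponents with `7rh / log (r + h)`. -/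

section Numerics

/-- Since `log 2 < 0.7`, a factor `exp (0.3 L)` is left over to beat `10 L`. -/
theorem two_pow_floor_mul_le {L : ℝ} (hL : 300 ≤ L) :
    (2 : ℝ) ^ ⌊L⌋₊ * (10 * L) ≤ Real.exp L := by
  have h1 : (2 : ℝ) ^ ⌊L⌋₊ ≤ Real.exp (0.7 * L) := by
    have h2 : (2 : ℝ) ≤ Real.exp 0.7 := by
      have := (Real.le_exp_log 2).trans (Real.exp_le_exp.2
        (show Real.log 2 ≤ 0.7 by linarith [Real.log_two_lt_d9]))
      exact this
    calc (2 : ℝ) ^ ⌊L⌋₊ ≤ Real.exp 0.7 ^ ⌊L⌋₊ := by gcongr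
      _ = Real.exp (⌊L⌋₊ * 0.7) := (Real.exp_nat_mul _ _).symm
      _ ≤ Real.exp (0.7 * L) := by
        rw [Real.exp_le_exp]
        linarith [Nat.floor_le (show 0 ≤ L by linarith)]
  have h3 : 10 * L ≤ Real.exp (0.3 * L) := by
    have := Real.quadratic_le_exp_of_nonneg (show 0 ≤ 0.3 * L by linarith)
    nlinarith
  calc (2 : ℝ) ^ ⌊L⌋₊ * (10 * L) ≤ Real.exp (0.7 * L) * Real.exp (0.3 * L) := by gcongr
    _ = Real.exp L := by rw [← Real.exp_add]; ring_nf

/-- `p` plays the role of `r * h`, and `D` that of `log (r + h)`. -/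
theorem exponent_bound {m M L p D : ℝ} {b q : ℕ} (hb : b = ⌊L⌋₊) (hL : 300 ≤ L)
    (hML : Real.log M = L) (hM0 : 0 < M) (hmM : m ≤ M) (hm : 10 * L ^ 2 ≤ m)
    (hq : (q : ℝ) ≤ m / b) (hp : 0.9 * (m * M) ≤ p) (hD0 : 0 < D) (hD : D ≤ 1.1 * L) :
    2 * M * (q + 1) + 3 * m * 2 ^ b + (q + 1) * 2 ^ b + 5 * M + 2 ≤ 7 * p / D := by
  have hexp : (2 : ℝ) ^ b * (10 * L) ≤ M := by
    rw [hb, ← Real.exp_log hM0, hML]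
    exact two_pow_floor_mul_le hL
  have hbL : 0.9 * L ≤ b := by
    rw [hb]
    linarith [Nat.lt_floor_add_one L]
  have hLpos : 0 < L := by linarith
  have hbpos : (0 : ℝ) < b := by linarith
  have hmpos : 0 < m := by nlinarith
  have hT0 : (0 : ℝ) < 2 ^ b := by positivity
  set T : ℝ := 2 ^ b
  -- `P` is the unit of cost: the left side stays below `3P`, mostly from `2Mq ≤ (2/0.9) P`, while
  -- the right side is at least `5P` because `7 · 0.9 / 1.1 > 5`.
  set P : ℝ := m * M / L with hP
  have hPL : P * L = m * M := by rw [hP]; field_simp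
  have hqm : (q : ℝ) * (0.9 * L) ≤ m := by
    rw [le_div_iff₀ hbpos] at hq
    exact (mul_le_mul_of_nonneg_left hbL (Nat.cast_nonneg _)).trans hq
  have hPpos : 0 < P := by positivity
  have hqM : 0.9 * (M * q) ≤ P := by
    rw [hP, le_div_iff₀ hLpos]
    nlinarith
  have hLm : 3000 * L ≤ m := by nlinarith
  have hM : 3000 * M ≤ P := by
    rw [hP, le_div_iff₀ hLpos]
    nlinarith [mul_le_mul_of_nonneg_right hLm hM0.le]
  have hmT : 10 * (m * T) ≤ P := by
    rw [hP, le_div_iff₀ hLpos]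
    nlinarith
  have hq1 : (q : ℝ) + 1 ≤ m := by nlinarith [Nat.cast_nonneg (α := ℝ) q]
  have hqT : (q + 1) * T ≤ m * T := by gcongr
  have hM2 : 2 ≤ M := by nlinarith
  have hR : 5 * P ≤ 7 * p / D := by
    rw [le_div_iff₀ hD0]
    nlinarith
  nlinarith

/-- A common majorant of the two block exponents, so both orderings of `r + 1` and `h` use one
estimate. -/
theorem exponent_bound_of_le {m M r h : ℕ} (hmM : m ≤ M) (hMexp : Real.exp 300 ≤ M)
    (hcond : 10 * Real.log M ^ 2 ≤ m) (hprod : (m : ℝ) * M = (r + 1) * h)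
    (hr : 10 ≤ r) (hh : 1 ≤ h) (hsum : r + h ≤ 2 * M) :
    (2 * M * (m / ⌊Real.log M⌋₊ + 1) + 3 * m * 2 ^ ⌊Real.log M⌋₊ +
      (m / ⌊Real.log M⌋₊ + 1) * 2 ^ ⌊Real.log M⌋₊ + 5 * M + 2 : ℕ) ≤
      7 * (r : ℝ) * h / Real.log (r + h) := by
  have hM0 : (0 : ℝ) < M := (Real.exp_pos _).trans_le hMexp
  have hL : 300 ≤ Real.log M := (Real.le_log_iff_exp_le hM0).2 hMexp
  have hr' : (10 : ℝ) ≤ r := by exact_mod_cast hr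
  have hh' : (1 : ℝ) ≤ h := by exact_mod_cast hh
  have hsum' : (r : ℝ) + h ≤ 2 * M := by exact_mod_cast hsum
  push_cast
  rw [mul_assoc 7]
  refine exponent_bound (m := m) (p := r * h) rfl hL rfl hM0 (by exact_mod_cast hmM) hcond
    Nat.cast_div_le ?_ (Real.log_pos (by linarith)) ?_
  · rw [hprod]
    nlinarith
  · calc Real.log (r + h) ≤ Real.log (2 * M) := Real.log_le_log (by linarith) hsum'
      _ = Real.log 2 + Real.log M := Real.log_mul (by norm_num) hM0.ne'
      _ ≤ 1.1 * Real.log M := by linarith [Real.log_two_lt_d9]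

end Numerics

theorem theorem3 :
    ∃ N : ℕ, ∀ r h : ℕ, N ≤ r → N ≤ h →
      10 * (Real.log (max ((r : ℝ) + 1) (h : ℝ))) ^ 2 ≤ min ((r : ℝ) + 1) (h : ℝ) →
      ∀ (G : Type*) [AddCommGroup G] [DecidableEq G] (A : Finset G) (K : ℝ) (lam : Fin h → ℤ),
        ((A + A).card : ℝ) = K * (A.card : ℝ) →
        (∀ i, lam i ≠ 0) →
        (∀ i, |lam i| ≤ 2 ^ r) →
        ((∑ i, dilate (lam i) A).card : ℝ) ≤
          K ^ (7 * (r : ℝ) * (h : ℝ) / Real.log ((r : ℝ) + (h : ℝ))) * (A.card : ℝ) := by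
  refine ⟨max 10 ⌈Real.exp 300⌉₊, fun r h hr hh hcond G _ _ A K lam hK h0 hlam => ?_⟩
  have hr10 : 10 ≤ r := (le_max_left _ _).trans hr
  have hh1 : 1 ≤ h := by have := (le_max_left 10 _).trans hh; omega
  have hrexp : Real.exp 300 ≤ r :=
    (Nat.le_ceil _).trans (by exact_mod_cast (le_max_right _ _).trans hr)
  have hhexp : Real.exp 300 ≤ h :=
    (Nat.le_ceil _).trans (by exact_mod_cast (le_max_right _ _).trans hh)
  -- For empty `A` nothing constrains `K`, but both sides vanish because `h ≥ 1`.
  rcases A.eq_empty_or_nonempty with rfl | hA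
  · have : ∑ i, dilate (lam i) (∅ : Finset G) = ∅ := by
      rw [← Finset.add_sum_erase _ _ (Finset.mem_univ (⟨0, hh1⟩ : Fin h))]
      simp [dilate]
    rw [this]
    simp
  have hpos : (0 : ℝ) < A.card := by exact_mod_cast hA.card_pos
  have hK1 : 1 ≤ K := by
    have : (A.card : ℝ) ≤ (A + A).card := by exact_mod_cast Finset.card_le_card_add_right hA
    rw [hK] at this
    exact le_of_mul_le_mul_right (by linarith) hpos
  have hn : ∀ i, |lam i| < 2 ^ (r + 1) := fun i =>
    (hlam i).trans_lt (pow_lt_pow_right₀ (by norm_num) (Nat.lt_succ_self r))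
  have key : ∀ E : ℕ, ((∑ i, dilate (lam i) A).card : ℝ) ≤ K ^ E * A.card →
      (E : ℝ) ≤ 7 * (r : ℝ) * h / Real.log (r + h) →
      ((∑ i, dilate (lam i) A).card : ℝ) ≤
        K ^ (7 * (r : ℝ) * h / Real.log (r + h)) * A.card := fun E h1 h2 => by
    refine h1.trans (mul_le_mul_of_nonneg_right ?_ hpos.le)
    rw [← Real.rpow_natCast]
    exact Real.rpow_le_rpow_of_exponent_le hK1 h2
  have floor_pos : ∀ M : ℕ, Real.exp 300 ≤ M → 0 < ⌊Real.log M⌋₊ := fun M hM =>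
    Nat.floor_pos.2 (le_trans (by norm_num)
      ((Real.le_log_iff_exp_le ((Real.exp_pos _).trans_le hM)).2 hM))
  -- The smaller side is the one cut into blocks.
  rcases le_total (r + 1) h with hle | hle
  · have hle' : (r : ℝ) + 1 ≤ h := by exact_mod_cast hle
    rw [max_eq_right hle', min_eq_left hle'] at hcond
    set b := ⌊Real.log h⌋₊ with hb
    refine key _ (card_sum_dilate_le_of_digit_blocks hA hK1 hK lam h0 (r + 1) hn b
      (floor_pos h hhexp)) (le_trans ?_ (exponent_bound_of_le (m := r + 1) (M := h) hle hhexp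
        (by push_cast; exact hcond) (by push_cast; ring) hr10 hh1 (by omega)))
    rw [← hb]
    norm_cast
    nlinarith [Nat.zero_le (h * ((r + 1) / b + 1)), Nat.zero_le ((r + 1) * 2 ^ b)]
  · have hle' : (h : ℝ) ≤ r + 1 := by exact_mod_cast hle
    rw [max_eq_left hle', min_eq_right hle'] at hcond
    have hcast : ((r + 1 : ℕ) : ℝ) = r + 1 := by push_cast; rfl
    have hexp' : Real.exp 300 ≤ (r + 1 : ℕ) := by rw [hcast]; linarith
    set b := ⌊Real.log (r + 1 : ℕ)⌋₊ with hb
    refine key _ (card_sum_dilate_le_of_coefficient_blocks hA hK1 hK lam h0 (r + 1) hn b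
      (floor_pos _ hexp')) (le_trans ?_ (exponent_bound_of_le (m := h) (M := r + 1) hle hexp'
        (by rw [hcast]; exact hcond) (by push_cast; ring) hr10 hh1 (by omega)))
    rw [← hb]
    norm_cast
    nlinarith [Nat.zero_le (h * 2 ^ b)]
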